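/- Let $F$ be a field of characteristic $0$ with algebraic closure $\overline F$, let $G$ be a linear (i.e. affine of finite type) algebraic group over $F$ (for example a reductive one), and let $T\subset G$ be a closed $F$-subgroup which is a torus, i.e. $T_{\overline F}\cong\mathbb G_m^n$ for some $n\ge 0$. Let ${}^{T}F[G]^{T}\subset F[G]$ be the ring of regular functions on $G$ invariant under left and right translation by $T$, let $T\backslash\!\backslash G/\!/T=\operatorname{Spec}\bigl({}^{T}F[G]^{T}\bigr)$ be the GIT double quotient, and let $\pi\colon G\to T\backslash\!\backslash G/\!/T$ be the morphism induced by the inclusion ${}^{T}F[G]^{T}\hookrightarrow F[G]$. Assume that $T$ is anisotropic over $F$, i.e. every character $T\to\mathbb G_m$ defined over $F$ is trivial. Then: 1. for every $g\in G(F)$ the double orbit $T(\overline F)\,g\,T(\overline F)$ is Zariski closed in $G(\overline F)$; 2. if $g\in G(F)$ satisfies $\pi(g)=\pi(e)$, where $e$ is the identity element of $G$, then $g\in T(F)$. -/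

import Mathlib

open scoped TensorProduct LaurentPolynomial

/-!
An affine (linear) algebraic group `G` over a field `F` is represented by its coordinate ring
`A = F[G]`, a commutative Hopf algebra of finite type over `F`. A closed subgroup `T` of `G` is
represented by its coordinate ring `B = F[T]` together with the restriction of functions
`φ : A →ₐc[F] B`, a surjective morphism of Hopf algebras.
-/

namespace DoubleTorusQuotient

noncomputable section

/-- The monoid (in fact group) `G(R)` of `R`-points of the affine algebraic group over `F` with
coordinate ring `A`. Multiplication is convolution: `(g * h)(f) = ∑ g(f₁) h(f₂)`, where
`Δ f = ∑ f₁ ⊗ f₂`; the identity element `1` is the counit. -/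
abbrev Points (F A R : Type*) [CommRing F] [CommRing A] [HopfAlgebra F A]
    [CommRing R] [Algebra F R] : Type _ :=
  WithConv (A →ₐ[F] R)

variable {F A B : Type*} [Field F] [CommRing A] [HopfAlgebra F A] [CommRing B] [HopfAlgebra F B]

/-- The map `T(R) → G(R)` on points given by the inclusion of the closed subgroup `T` in `G`. -/
def subgroupPoint (φ : A →ₐc[F] B) {R : Type*} [CommRing R] [Algebra F R]
    (t : Points F B R) : Points F A R :=
  WithConv.toConv (t.ofConv.comp (φ : A →ₐ[F] B))

/-- The map `G(F) → G(K)` for a field extension `K/F`. -/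
def extendPoint (K : Type*) [Field K] [Algebra F K] (g : Points F A F) : Points F A K :=
  WithConv.toConv ((Algebra.ofId F K).comp g.ofConv)

/-- The algebraic group over `F` with coordinate ring `B` is a torus: over the algebraic closure
`K` of `F` it becomes isomorphic, as an algebraic group, to `𝔾ₘⁿ` for some `n`, whose coordinate
ring is the group algebra of `ℤⁿ`. -/
def IsTorus (F K B : Type*) [Field F] [Field K] [Algebra F K] [CommRing B] [HopfAlgebra F B] :
    Prop :=
  ∃ n : ℕ, Nonempty ((K ⊗[F] B) ≃ₐc[K] AddMonoidAlgebra K (Fin n → ℤ))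

/-- The torus over `F` with coordinate ring `B` is anisotropic over `F`: every character `T → 𝔾ₘ`
defined over `F`, i.e. every morphism of Hopf algebras `F[X, X⁻¹] → B`, is trivial. -/
def IsAnisotropic (F B : Type*) [Field F] [CommRing B] [HopfAlgebra F B] : Prop :=
  ∀ χ : F[T;T⁻¹] →ₐc[F] B,
    χ = (Bialgebra.unitBialgHom F B).comp (Bialgebra.counitBialgHom F F[T;T⁻¹])

/-- The comorphism `F[G] → F[T] ⊗ F[G]` of `T × G → G`, `(t, g) ↦ t g`. -/
def leftCoaction (φ : A →ₐc[F] B) : A →ₐ[F] B ⊗[F] A :=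
  (Algebra.TensorProduct.map (φ : A →ₐ[F] B) (AlgHom.id F A)).comp (Bialgebra.comulAlgHom F A)

/-- The comorphism `F[G] → F[G] ⊗ F[T]` of `G × T → G`, `(g, t) ↦ g t`. -/
def rightCoaction (φ : A →ₐc[F] B) : A →ₐ[F] A ⊗[F] B :=
  (Algebra.TensorProduct.map (AlgHom.id F A) (φ : A →ₐ[F] B)).comp (Bialgebra.comulAlgHom F A)

/-- The ring `ᵀF[G]ᵀ` of regular functions on `G` that are invariant under both left and right
translations by `T`. -/
def invariants (φ : A →ₐc[F] B) : Subalgebra F A :=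
  AlgHom.equalizer (leftCoaction φ) Algebra.TensorProduct.includeRight ⊓
    AlgHom.equalizer (rightCoaction φ) Algebra.TensorProduct.includeLeft

/-- The set of `R`-points of the GIT double quotient `T \\ G // T = Spec (ᵀF[G]ᵀ)`. -/
abbrev QuotientPoints (φ : A →ₐc[F] B) (R : Type*) [CommRing R] [Algebra F R] : Type _ :=
  invariants φ →ₐ[F] R

/-- The quotient morphism `π : G → T \\ G // T` on `R`-points; it is induced by the inclusion of
the ring of invariants in `F[G]`. -/
def quotientMap (φ : A →ₐc[F] B) {R : Type*} [CommRing R] [Algebra F R]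
    (g : Points F A R) : QuotientPoints φ R :=
  g.ofConv.comp (invariants φ).val

/-- The double orbit `T(K) g T(K)` of a point `g ∈ G(K)`. -/
def doubleOrbit (φ : A →ₐc[F] B) {K : Type*} [Field K] [Algebra F K]
    (g : Points F A K) : Set (Points F A K) :=
  {h | ∃ tL tR : Points F B K, h = subgroupPoint φ tL * g * subgroupPoint φ tR}

/-- The value at a point `g ∈ G(K)` of a regular function on the base change of `G` to `K`. -/
def evalAt {K : Type*} [Field K] [Algebra F K] (g : Points F A K) : (K ⊗[F] A) →ₐ[K] K :=
  Algebra.TensorProduct.lift (AlgHom.id K K) g.ofConv (fun _ _ => Commute.all _ _)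

/-- A subset of `G(K)` is Zariski closed if it is the set of common zeros of a set of regular
functions on the base change of `G` to `K`. -/
def IsZariskiClosed {K : Type*} [Field K] [Algebra F K] (Z : Set (Points F A K)) : Prop :=
  ∃ S : Set (K ⊗[F] A), Z = {g | ∀ f ∈ S, evalAt g f = 0}

end

end DoubleTorusQuotient

/-! Over `K` the torus splits, so its characters form a basis of `K ⊗ B`, and `K ⊗ A` is the sum of
the simultaneous weight spaces for left and right translation by `T`; weights are pairs of
characters. For a point `g`, the weights of weight vectors not vanishing at `g` form a monoid, since
products of such vectors do not vanish at `g`.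

If `g` is rational over `F`, this monoid is stable under the Galois group. The product of the finite
Galois orbit of a weight is a Galois-invariant pair of characters; it descends to `F` and is trivial
because `T` is anisotropic. Thus the inverse of a weight is the product of its other conjugates, and
the monoid is a group (`CharacterBasis.inv_mem`).

The double orbit of `g` is then cut out by the weight vectors vanishing at `g` (`mem_doubleOrbit`).
If they all vanish at `h`, evaluation at `h` is evaluation at `g` scaled by a factor depending only
on the weight. This factor is a homomorphism from the group of weights to `Kˣ`; as `Kˣ` is divisible
it extends to all pairs of characters, which gives `tL` and `tR` with `h = tL g tR`.

For the second claim, suppose a weight vector vanishes at `e` but not at `g`. Multiplying it by one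
of inverse weight that is nonzero at `g` gives an invariant function separating `g` from `e`,
contrary to `π(g) = π(e)`. Hence `g` lies in the double orbit of `e`, which is `T(K)`, and
rationality puts it in `T(F)`. -/

namespace DoubleTorusQuotient

open Algebra.TensorProduct (includeLeft includeRight)

noncomputable section

/-! ### Base change to `K`: Galois action, evaluation, coefficients along a basis of `K ⊗ B` -/

section BaseChange

variable {F : Type*} [Field F] (K : Type*) [Field K] [Algebra F K]
variable {M N P B : Type*} [CommRing M] [Algebra F M] [CommRing N] [Algebra F N]
  [CommRing P] [Algebra F P] [CommRing B] [Algebra F B]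

/-- The base change to `K` of a homomorphism of `F`-algebras. -/
def bc (f : M →ₐ[F] N) : K ⊗[F] M →ₐ[K] K ⊗[F] N :=
  Algebra.TensorProduct.map (AlgHom.id K K) f

variable {K}

@[simp]
lemma bc_tmul (f : M →ₐ[F] N) (k : K) (m : M) : bc K f (k ⊗ₜ m) = k ⊗ₜ f m := rfl

lemma bc_comp (f : N →ₐ[F] P) (g : M →ₐ[F] N) (z : K ⊗[F] M) :
    bc K (f.comp g) z = bc K f (bc K g z) := by
  induction z with
  | zero => simp
  | add x y hx hy => simp [hx, hy]
  | tmul k m => rfl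

lemma bc_id (z : K ⊗[F] M) : bc K (AlgHom.id F M) z = z := by
  induction z with
  | zero => simp
  | add x y hx hy => simp [hx, hy]
  | tmul k m => rfl

lemma bc_bc_of_comp_eq {f : N →ₐ[F] P} {g : M →ₐ[F] N} {h : M →ₐ[F] P} (hfg : f.comp g = h)
    (z : K ⊗[F] M) : bc K f (bc K g z) = bc K h z := by
  rw [← bc_comp, hfg]

/-- The first embedding `K[B] → K[B ⊗ M]`. -/
abbrev inl (M : Type*) [CommRing M] [Algebra F M] : K ⊗[F] B →ₐ[K] K ⊗[F] (B ⊗[F] M) :=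
  bc K (includeLeft : B →ₐ[F] B ⊗[F] M)

/-- The second embedding `K[M] → K[B ⊗ M]`. -/
abbrev inr (B : Type*) [CommRing B] [Algebra F B] : K ⊗[F] M →ₐ[K] K ⊗[F] (B ⊗[F] M) :=
  bc K (includeRight : M →ₐ[F] B ⊗[F] M)

lemma bc_map_inl (θ : M →ₐ[F] N) (z : K ⊗[F] B) :
    bc K (Algebra.TensorProduct.map (AlgHom.id F B) θ) (inl M z) = inl N z :=
  bc_bc_of_comp_eq (by ext; simp) z

lemma bc_map_inr (θ : M →ₐ[F] N) (z : K ⊗[F] M) :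
    bc K (Algebra.TensorProduct.map (AlgHom.id F B) θ) (inr B z) = inr B (bc K θ z) := by
  induction z with
  | zero => simp only [map_zero]
  | add x y hx hy => simp only [map_add, hx, hy]
  | tmul k m => simp

lemma bc_leftComm_inl (z : K ⊗[F] B) :
    bc K (Algebra.TensorProduct.leftComm F B B M).toAlgHom (inl (B ⊗[F] M) z) =
      inr B (inl M z) := by
  induction z with
  | zero => simp only [map_zero]
  | add x y hx hy => simp only [map_add, hx, hy]
  | tmul k m => simp [Algebra.TensorProduct.one_def]

lemma bc_leftComm_inr_inl (z : K ⊗[F] B) :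
    bc K (Algebra.TensorProduct.leftComm F B B M).toAlgHom (inr B (inl M z)) =
      inl (B ⊗[F] M) z := by
  induction z with
  | zero => simp only [map_zero]
  | add x y hx hy => simp only [map_add, hx, hy]
  | tmul k m => simp [Algebra.TensorProduct.one_def]

lemma bc_leftComm_inr_inr (z : K ⊗[F] M) :
    bc K (Algebra.TensorProduct.leftComm F B B M).toAlgHom (inr B (inr B z)) =
      inr B (inr B z) := by
  induction z with
  | zero => simp only [map_zero]
  | add x y hx hy => simp only [map_add, hx, hy]
  | tmul k m => simp

lemma bc_assoc_inl (Δ : B →ₐ[F] B ⊗[F] B) (z : K ⊗[F] B) :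
    bc K (Algebra.TensorProduct.assoc F F F B B M).toAlgHom
      (bc K (Algebra.TensorProduct.map Δ (AlgHom.id F M)) (inl M z)) =
    bc K (Algebra.TensorProduct.map (AlgHom.id F B) includeLeft) (bc K Δ z) := by
  induction z with
  | zero => simp only [map_zero]
  | add x y hx hy => simp only [map_add, hx, hy]
  | tmul k a =>
    simp only [bc_tmul, Algebra.TensorProduct.includeLeft_apply,
      Algebra.TensorProduct.map_tmul, map_one]
    congr 1
    generalize Δ a = w
    induction w with
    | zero => simp
    | add x y hx hy => rw [TensorProduct.add_tmul, map_add, map_add, hx, hy]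
    | tmul x y => simp

lemma bc_assoc_inr (Δ : B →ₐ[F] B ⊗[F] B) (z : K ⊗[F] M) :
    bc K (Algebra.TensorProduct.assoc F F F B B M).toAlgHom
      (bc K (Algebra.TensorProduct.map Δ (AlgHom.id F M)) (inr B z)) = inr B (inr B z) := by
  induction z with
  | zero => simp only [map_zero]
  | add x y hx hy => simp only [map_add, hx, hy]
  | tmul k m => simp [Algebra.TensorProduct.one_def]

lemma lift_comp_includeRight (f : B →ₐ[F] N) (g : M →ₐ[F] N) :
    (Algebra.TensorProduct.lift f g fun _ _ => Commute.all _ _).comp includeRight = g := by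
  ext; simp

/-- The automorphism of `K ⊗ M` induced by an automorphism of `K` over `F`. -/
def gal (σ : K ≃ₐ[F] K) (M : Type*) [CommRing M] [Algebra F M] : K ⊗[F] M →ₐ[F] K ⊗[F] M :=
  Algebra.TensorProduct.map (σ : K →ₐ[F] K) (AlgHom.id F M)

@[simp]
lemma gal_tmul (σ : K ≃ₐ[F] K) (k : K) (m : M) : gal σ M (k ⊗ₜ m) = σ k ⊗ₜ m := rfl

lemma gal_bc (σ : K ≃ₐ[F] K) (f : M →ₐ[F] N) (z : K ⊗[F] M) :
    gal σ N (bc K f z) = bc K f (gal σ M z) := by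
  induction z with
  | zero => simp
  | add x y hx hy => simp [hx, hy]
  | tmul k m => rfl

lemma gal_gal (σ τ : K ≃ₐ[F] K) (z : K ⊗[F] M) : gal σ M (gal τ M z) = gal (σ * τ) M z := by
  induction z with
  | zero => simp
  | add x y hx hy => simp [hx, hy]
  | tmul k m => rfl

lemma gal_one (z : K ⊗[F] M) : gal 1 M z = z := by
  induction z with
  | zero => simp
  | add x y hx hy => simp [hx, hy]
  | tmul k m => rfl

/-- The `K`-linear extension to `K ⊗ M` of a `K`-valued point of `M`. -/
def ev (p : M →ₐ[F] K) : K ⊗[F] M →ₐ[K] K :=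
  Algebra.TensorProduct.lift (AlgHom.id K K) p (fun _ _ => Commute.all _ _)

@[simp]
lemma ev_tmul (p : M →ₐ[F] K) (k : K) (m : M) : ev p (k ⊗ₜ m) = k * p m := rfl

lemma ev_bc (p : N →ₐ[F] K) (f : M →ₐ[F] N) (z : K ⊗[F] M) :
    ev p (bc K f z) = ev (p.comp f) z := by
  induction z with
  | zero => simp
  | add x y hx hy => simp [hx, hy]
  | tmul k m => rfl

/-- Rationality of the point matters here: `σ` fixes the values in `F` of functions defined over
`F`, so it acts only on the scalars. -/
lemma ev_gal (σ : K ≃ₐ[F] K) (p : M →ₐ[F] F) (z : K ⊗[F] M) :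
    ev ((Algebra.ofId F K).comp p) (gal σ M z) = σ (ev ((Algebra.ofId F K).comp p) z) := by
  induction z with
  | zero => simp
  | add x y hx hy => simp [hx, hy]
  | tmul k m => simp [Algebra.ofId_apply]

/-- The coordinate `K[B] → K` of index `x` with respect to a basis of `K[B]` over `K`, extended to
`K[B ⊗ M] → K[M]`. -/
def coeff {X : Type*} (b : Module.Basis X K (K ⊗[F] B)) (x : X) (M : Type*) [CommRing M]
    [Algebra F M] : K ⊗[F] (B ⊗[F] M) →ₗ[F] K ⊗[F] M :=
  LinearMap.rTensor M ((b.coord x).restrictScalars F) ∘ₗ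
    (TensorProduct.assoc F K B M).symm.toLinearMap

lemma coeff_inl_mul_inr {X : Type*} [DecidableEq X] (b : Module.Basis X K (K ⊗[F] B)) (x : X)
    (u : K ⊗[F] B) (m : K ⊗[F] M) :
    coeff b x M (inl M u * inr B m) = b.repr u x • m := by
  induction m with
  | zero => simp
  | add y z hy hz => simp [mul_add, hy, hz]
  | tmul k m =>
    have h : inl M u * inr B (k ⊗ₜ[F] m) =
        TensorProduct.assoc F K B M ((k • u) ⊗ₜ[F] m) := by
      induction u with
      | zero => simp
      | add y z hy hz =>
        rw [map_add, add_mul, smul_add, TensorProduct.add_tmul, map_add, hy, hz]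
      | tmul l n => simp [TensorProduct.smul_tmul', mul_comm]
    rw [h]
    simp [coeff, TensorProduct.smul_tmul', mul_comm]

lemma exists_eq_sum_inl_mul_inr {X : Type*} (b : Module.Basis X K (K ⊗[F] B))
    (z : K ⊗[F] (B ⊗[F] M)) :
    ∃ c : X →₀ K ⊗[F] M, z = c.sum fun x m => inl M (b x) * inr B m := by
  have hadd (c d : X →₀ K ⊗[F] M) : ((c + d).sum fun x m => inl M (b x) * inr B m) =
      (c.sum fun x m => inl M (b x) * inr B m) + d.sum fun x m => inl M (b x) * inr B m := by
    classical
    exact Finsupp.sum_add_index' (by simp) (by simp [mul_add])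
  induction z with
  | zero => exact ⟨0, by simp⟩
  | add y z hy hz =>
    obtain ⟨c, rfl⟩ := hy
    obtain ⟨d, rfl⟩ := hz
    exact ⟨c + d, (hadd c d).symm⟩
  | tmul k w =>
    induction w with
    | zero => exact ⟨0, by simp⟩
    | add y z hy hz =>
      obtain ⟨c, hc⟩ := hy
      obtain ⟨d, hd⟩ := hz
      exact ⟨c + d, by rw [hadd, TensorProduct.tmul_add, hc, hd]⟩
    | tmul n m =>
      refine ⟨(b.repr (k ⊗ₜ n)).mapRange (fun a => a ⊗ₜ[F] m) (by simp), ?_⟩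
      rw [Finsupp.sum_mapRange_index (by simp)]
      have h : k ⊗ₜ[F] (n ⊗ₜ[F] m) = inl M (k ⊗ₜ[F] n) * inr B (1 ⊗ₜ[F] m) := by simp
      rw [h]
      conv_lhs => rw [← b.linearCombination_repr (k ⊗ₜ n)]
      rw [Finsupp.linearCombination_apply, Finsupp.sum, map_sum, Finset.sum_mul, Finsupp.sum]
      refine Finset.sum_congr rfl fun x _ => ?_
      rw [map_smul, smul_mul_assoc, ← mul_smul_comm, ← map_smul, TensorProduct.smul_tmul',
        smul_eq_mul, mul_one]

/-- Coefficients with respect to a basis of `K[B]` are unique. -/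
lemma eq_of_sum_eq_sum {X : Type*} (b : Module.Basis X K (K ⊗[F] B)) {c d : X → K ⊗[F] M}
    {s : Finset X} (h : ∑ x ∈ s, inl M (b x) * inr B (c x) = ∑ x ∈ s, inl M (b x) * inr B (d x))
    {x : X} (hx : x ∈ s) : c x = d x := by
  classical
  -- The coordinate functional of `x` annihilates every summand except the one of index `x`.
  have := congrArg (coeff b x M) h
  simpa [coeff_inl_mul_inr, Finsupp.single_apply, hx] using this

end BaseChange

/-! ### Weight vectors and weight decomposition for abstract coactions -/

section Weight

variable {F : Type*} [Field F] {K : Type*} [Field K] [Algebra F K]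
variable {A B : Type*} [CommRing A] [Algebra F A] [CommRing B] [Algebra F B]

/-- The function `f` is a weight vector of weight `u` for the coaction `ρ`. -/
def IsWeight (ρ : A →ₐ[F] B ⊗[F] A) (u : K ⊗[F] B) (f : K ⊗[F] A) : Prop :=
  bc K ρ f = inl A u * inr B f

variable {ρ ρ' : A →ₐ[F] B ⊗[F] A} {u v : K ⊗[F] B} {f g : K ⊗[F] A}

lemma IsWeight.one : IsWeight ρ (1 : K ⊗[F] B) 1 := by simp [IsWeight]

lemma IsWeight.mul (hf : IsWeight ρ u f) (hg : IsWeight ρ v g) : IsWeight ρ (u * v) (f * g) := by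
  unfold IsWeight at *
  simp only [map_mul, hf, hg]
  ring

lemma IsWeight.sub (hf : IsWeight ρ u f) (hg : IsWeight ρ u g) : IsWeight ρ u (f - g) := by
  unfold IsWeight at *
  simp only [map_sub, hf, hg]
  ring

lemma IsWeight.smul (k : K) (hf : IsWeight ρ u f) : IsWeight ρ u (k • f) := by
  unfold IsWeight at *
  rw [map_smul, hf, map_smul, mul_smul_comm]

lemma IsWeight.gal (σ : K ≃ₐ[F] K) (hf : IsWeight ρ u f) :
    IsWeight ρ (gal σ B u) (gal σ A f) := by
  unfold IsWeight at *
  rw [← gal_bc, hf, map_mul, gal_bc, gal_bc]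

lemma IsWeight.ev_lift (hf : IsWeight ρ u f) (t : B →ₐ[F] K) (h : A →ₐ[F] K) :
    ev ((Algebra.TensorProduct.lift t h fun _ _ => Commute.all _ _).comp ρ) f =
      ev t u * ev h f := by
  rw [← ev_bc, hf, map_mul, ev_bc, ev_bc, Algebra.TensorProduct.lift_comp_includeLeft,
    lift_comp_includeRight]

/-- The homogeneous components of a function are weight vectors. -/
lemma isWeight_of_sum {X : Type*} (b : Module.Basis X K (K ⊗[F] B)) {Δ : B →ₐ[F] B ⊗[F] B}
    (hΔ : ∀ x, bc K Δ (b x) = inl B (b x) * inr B (b x))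
    (hρ : (Algebra.TensorProduct.map (AlgHom.id F B) ρ).comp ρ =
      (Algebra.TensorProduct.assoc F F F B B A).toAlgHom.comp
        ((Algebra.TensorProduct.map Δ (AlgHom.id F A)).comp ρ))
    {c : X →₀ K ⊗[F] A} (hf : bc K ρ f = c.sum fun x m => inl A (b x) * inr B m) (x : X) :
    IsWeight ρ (b x) (c x) := by
  by_cases hx : x ∈ c.support
  swap
  · simp [IsWeight, Finsupp.notMem_support_iff.mp hx]
  -- Coassociativity gives two expansions of the twice coacted `f`; comparing the coefficients of `b
  -- x` in the first factor yields the weight equation for `c x`.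
  have h := congrArg (fun θ => bc K θ f) hρ
  simp only [bc_comp, hf, Finsupp.sum, map_sum, map_mul] at h
  refine eq_of_sum_eq_sum (M := B ⊗[F] A) b
    (c := fun x => bc K ρ (c x)) (d := fun x => inl A (b x) * inr B (c x)) ?_ hx
  simpa only [bc_map_inl, bc_map_inr, bc_assoc_inl, bc_assoc_inr, hΔ, map_mul, mul_assoc] using h

/-- The components of a weight vector under a commuting coaction are weight vectors of the same
weight. -/
lemma IsWeight.of_sum {X : Type*} (b : Module.Basis X K (K ⊗[F] B))
    (hρ : (Algebra.TensorProduct.map (AlgHom.id F B) ρ).comp ρ' =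
      (Algebra.TensorProduct.leftComm F B B A).toAlgHom.comp
        ((Algebra.TensorProduct.map (AlgHom.id F B) ρ').comp ρ))
    {c : X →₀ K ⊗[F] A} (hf : bc K ρ' f = c.sum fun x m => inl A (b x) * inr B m)
    (hu : IsWeight ρ u f) (x : X) :
    IsWeight ρ u (c x) := by
  by_cases hx : x ∈ c.support
  swap
  · simp [IsWeight, Finsupp.notMem_support_iff.mp hx]
  -- Here the two expansions come from applying the commuting coactions in either order.
  have h := congrArg (fun θ => bc K θ f) hρ
  unfold IsWeight at hu
  simp only [bc_comp, hf, hu, Finsupp.sum, map_sum, map_mul] at h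
  refine eq_of_sum_eq_sum (M := B ⊗[F] A) b
    (c := fun x => bc K ρ (c x)) (d := fun x => inl A u * inr B (c x)) ?_ hx
  simp only [bc_map_inl, bc_map_inr, bc_leftComm_inl, hf, Finsupp.sum, map_sum, map_mul,
    bc_leftComm_inr_inl, bc_leftComm_inr_inr, Finset.mul_sum] at h
  simpa only [map_mul, mul_left_comm] using h

/-- A function is the sum of its homogeneous components. -/
lemma eq_sum_of_sum {X : Type*} (b : Module.Basis X K (K ⊗[F] B)) {ε : B →ₐ[F] F}
    (hε : ∀ x, bc K ε (b x) = 1)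
    (hρ : (Algebra.TensorProduct.lift ((Algebra.ofId F A).comp ε) (AlgHom.id F A)
      fun _ _ => Commute.all _ _).comp ρ = AlgHom.id F A)
    {c : X →₀ K ⊗[F] A} (hf : bc K ρ f = c.sum fun x m => inl A (b x) * inr B m) :
    f = c.sum fun _ m => m := by
  have h := congrArg (fun θ => bc K θ f) hρ
  simp only [bc_comp, hf, Finsupp.sum, map_sum, map_mul, bc_id] at h
  rw [← h]
  refine Finset.sum_congr rfl fun x _ => ?_
  simp only [← bc_comp]
  rw [Algebra.TensorProduct.lift_comp_includeLeft, lift_comp_includeRight,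
    bc_comp, hε, map_one, one_mul, bc_id]

/-- Two commuting coactions by a torus: every function is a sum of common weight vectors. -/
lemma mem_of_isWeight_mem {X : Type*} (b : Module.Basis X K (K ⊗[F] B))
    {Δ Δ' : B →ₐ[F] B ⊗[F] B} {ε : B →ₐ[F] F}
    (hΔ : ∀ x, bc K Δ (b x) = inl B (b x) * inr B (b x))
    (hΔ' : ∀ x, bc K Δ' (b x) = inl B (b x) * inr B (b x))
    (hε : ∀ x, bc K ε (b x) = 1)
    (hρ : (Algebra.TensorProduct.map (AlgHom.id F B) ρ).comp ρ =
      (Algebra.TensorProduct.assoc F F F B B A).toAlgHom.comp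
        ((Algebra.TensorProduct.map Δ (AlgHom.id F A)).comp ρ))
    (hρ' : (Algebra.TensorProduct.map (AlgHom.id F B) ρ').comp ρ' =
      (Algebra.TensorProduct.assoc F F F B B A).toAlgHom.comp
        ((Algebra.TensorProduct.map Δ' (AlgHom.id F A)).comp ρ'))
    (hρρ' : (Algebra.TensorProduct.map (AlgHom.id F B) ρ).comp ρ' =
      (Algebra.TensorProduct.leftComm F B B A).toAlgHom.comp
        ((Algebra.TensorProduct.map (AlgHom.id F B) ρ').comp ρ))
    (hρε : (Algebra.TensorProduct.lift ((Algebra.ofId F A).comp ε) (AlgHom.id F A)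
      fun _ _ => Commute.all _ _).comp ρ = AlgHom.id F A)
    (hρε' : (Algebra.TensorProduct.lift ((Algebra.ofId F A).comp ε) (AlgHom.id F A)
      fun _ _ => Commute.all _ _).comp ρ' = AlgHom.id F A)
    (S : AddSubmonoid (K ⊗[F] A))
    (hS : ∀ x y f, IsWeight ρ (b x) f → IsWeight ρ' (b y) f → f ∈ S) (f : K ⊗[F] A) : f ∈ S := by
  -- Decompose under `ρ`, then each component under `ρ'`; the second decomposition preserves the
  -- `ρ`-weight.
  obtain ⟨c, hc⟩ := exists_eq_sum_inl_mul_inr b (bc K ρ f)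
  rw [eq_sum_of_sum b hε hρε hc]
  refine S.sum_mem fun x _ => ?_
  have hx := isWeight_of_sum b hΔ hρ hc x
  obtain ⟨d, hd⟩ := exists_eq_sum_inl_mul_inr b (bc K ρ' (c x))
  show c x ∈ S
  rw [eq_sum_of_sum b hε hρε' hd]
  exact S.sum_mem fun y _ => hS x y _ (hx.of_sum b hρρ' hd y) (isWeight_of_sum b hΔ' hρ' hd y)

end Weight

/-! ### Translations by the subgroup satisfy the coaction axioms -/

section Coactions

open Coalgebra

variable {F A B : Type*} [Field F] [CommRing A] [HopfAlgebra F A] [CommRing B] [HopfAlgebra F B]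

/-- The right coaction with its tensor factors exchanged. -/
def rightCoaction' (φ : A →ₐc[F] B) : A →ₐ[F] B ⊗[F] A :=
  (Algebra.TensorProduct.comm F A B).toAlgHom.comp (rightCoaction φ)

variable (φ : A →ₐc[F] B)

lemma leftCoaction_apply (a : A) : leftCoaction φ a =
    Algebra.TensorProduct.map (φ : A →ₐ[F] B) (AlgHom.id F A) (comul (R := F) a) := rfl

lemma rightCoaction'_apply (a : A) : rightCoaction' φ a = Algebra.TensorProduct.comm F A B
    (Algebra.TensorProduct.map (AlgHom.id F A) (φ : A →ₐ[F] B) (comul (R := F) a)) := rfl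

lemma comul_map (a : A) : Bialgebra.comulAlgHom F B ((φ : A →ₐ[F] B) a) =
    Algebra.TensorProduct.map (φ : A →ₐ[F] B) (φ : A →ₐ[F] B) (comul (R := F) a) :=
  (CoalgHomClass.map_comp_comul_apply φ a).symm

lemma leftCoaction_coassoc :
    (Algebra.TensorProduct.map (AlgHom.id F B) (leftCoaction φ)).comp (leftCoaction φ) =
      (Algebra.TensorProduct.assoc F F F B B A).toAlgHom.comp
        ((Algebra.TensorProduct.map (Bialgebra.comulAlgHom F B) (AlgHom.id F A)).comp
          (leftCoaction φ)) := by
  let L : A ⊗[F] (A ⊗[F] A) →ₐ[F] B ⊗[F] (B ⊗[F] A) :=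
    Algebra.TensorProduct.map (φ : A →ₐ[F] B)
      (Algebra.TensorProduct.map (φ : A →ₐ[F] B) (AlgHom.id F A))
  have h₁ (w : A ⊗[F] A) : Algebra.TensorProduct.map (AlgHom.id F B) (leftCoaction φ)
      (Algebra.TensorProduct.map (φ : A →ₐ[F] B) (AlgHom.id F A) w) =
      L (LinearMap.lTensor A comul w) := by
    induction w with
    | zero => simp only [map_zero]
    | add x y hx hy => simp only [map_add, hx, hy]
    | tmul x y => simp [L, leftCoaction_apply]
  have h₂ (w : A ⊗[F] A) : Algebra.TensorProduct.assoc F F F B B A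
      (Algebra.TensorProduct.map (Bialgebra.comulAlgHom F B) (AlgHom.id F A)
      (Algebra.TensorProduct.map (φ : A →ₐ[F] B) (AlgHom.id F A) w)) =
      L (TensorProduct.assoc F A A A (LinearMap.rTensor A comul w)) := by
    induction w with
    | zero => simp only [map_zero]
    | add x y hx hy => simp only [map_add, hx, hy]
    | tmul x y =>
      simp only [Algebra.TensorProduct.map_tmul, AlgHom.id_apply, comul_map, LinearMap.rTensor_tmul]
      generalize comul (R := F) x = v
      induction v with
      | zero => simp
      | add x y hx hy => simp only [map_add, TensorProduct.add_tmul, hx, hy]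
      | tmul x y => simp [L]
  ext a
  exact (h₁ _).trans ((congrArg L (coassoc_apply a).symm).trans (h₂ _).symm)

/-- Writing a right action with `B` on the left reverses the order of multiplication in `T`, hence
the flipped comultiplication. -/
lemma rightCoaction'_coassoc :
    (Algebra.TensorProduct.map (AlgHom.id F B) (rightCoaction' φ)).comp (rightCoaction' φ) =
      (Algebra.TensorProduct.assoc F F F B B A).toAlgHom.comp
        ((Algebra.TensorProduct.map
          ((Algebra.TensorProduct.comm F B B).toAlgHom.comp (Bialgebra.comulAlgHom F B))
          (AlgHom.id F A)).comp (rightCoaction' φ)) := by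
  let L : A ⊗[F] (A ⊗[F] A) →ₐ[F] B ⊗[F] (B ⊗[F] A) :=
    (Algebra.TensorProduct.map (φ : A →ₐ[F] B)
      (Algebra.TensorProduct.map (φ : A →ₐ[F] B) (AlgHom.id F A))).comp
    ((Algebra.TensorProduct.assoc F F F A A A).toAlgHom.comp
      ((Algebra.TensorProduct.comm F A (A ⊗[F] A)).toAlgHom.comp
        (Algebra.TensorProduct.map (AlgHom.id F A)
          (Algebra.TensorProduct.comm F A A).toAlgHom)))
  have h₁ (w : A ⊗[F] A) : Algebra.TensorProduct.map (AlgHom.id F B) (rightCoaction' φ)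
      (Algebra.TensorProduct.comm F A B
        (Algebra.TensorProduct.map (AlgHom.id F A) (φ : A →ₐ[F] B) w)) =
      L (TensorProduct.assoc F A A A (LinearMap.rTensor A comul w)) := by
    induction w with
    | zero => simp only [map_zero]
    | add x y hx hy => simp only [map_add, hx, hy]
    | tmul x y =>
      simp only [Algebra.TensorProduct.map_tmul, Algebra.TensorProduct.comm_tmul,
        AlgHom.id_apply, rightCoaction'_apply, LinearMap.rTensor_tmul]
      generalize comul (R := F) x = v
      induction v with
      | zero => simp
      | add x y hx hy =>
        simp only [map_add, TensorProduct.add_tmul, TensorProduct.tmul_add, hx, hy]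
      | tmul x y => simp [L]
  have h₂ (w : A ⊗[F] A) : Algebra.TensorProduct.assoc F F F B B A
      (Algebra.TensorProduct.map
        ((Algebra.TensorProduct.comm F B B).toAlgHom.comp (Bialgebra.comulAlgHom F B))
        (AlgHom.id F A)
      (Algebra.TensorProduct.comm F A B
        (Algebra.TensorProduct.map (AlgHom.id F A) (φ : A →ₐ[F] B) w))) =
      L (LinearMap.lTensor A comul w) := by
    induction w with
    | zero => simp only [map_zero]
    | add x y hx hy => simp only [map_add, hx, hy]
    | tmul x y =>
      simp only [Algebra.TensorProduct.map_tmul, Algebra.TensorProduct.comm_tmul,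
        AlgHom.id_apply, AlgHom.comp_apply, comul_map, LinearMap.lTensor_tmul]
      generalize comul (R := F) y = v
      induction v with
      | zero => simp
      | add x y hx hy =>
        simp only [map_add, TensorProduct.add_tmul, TensorProduct.tmul_add, hx, hy]
      | tmul x y => simp [L]
  ext a
  exact (h₁ _).trans ((congrArg L (coassoc_apply a)).trans (h₂ _).symm)

/-- Left and right translations commute: both sides are a permutation of the iterated
comultiplication, so this is coassociativity of `A`. -/
lemma leftCoaction_rightCoaction'_comm :
    (Algebra.TensorProduct.map (AlgHom.id F B) (leftCoaction φ)).comp (rightCoaction' φ) =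
      (Algebra.TensorProduct.leftComm F B B A).toAlgHom.comp
        ((Algebra.TensorProduct.map (AlgHom.id F B) (rightCoaction' φ)).comp
          (leftCoaction φ)) := by
  let L : A ⊗[F] (A ⊗[F] A) →ₐ[F] B ⊗[F] (B ⊗[F] A) :=
    (Algebra.TensorProduct.map (φ : A →ₐ[F] B)
      (Algebra.TensorProduct.map (φ : A →ₐ[F] B) (AlgHom.id F A))).comp
    ((Algebra.TensorProduct.comm F (A ⊗[F] A) A).toAlgHom.comp
      (Algebra.TensorProduct.assoc F F F A A A).symm.toAlgHom)
  have h₁ (w : A ⊗[F] A) : Algebra.TensorProduct.map (AlgHom.id F B) (leftCoaction φ)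
      (Algebra.TensorProduct.comm F A B
        (Algebra.TensorProduct.map (AlgHom.id F A) (φ : A →ₐ[F] B) w)) =
      L (TensorProduct.assoc F A A A (LinearMap.rTensor A comul w)) := by
    induction w with
    | zero => simp only [map_zero]
    | add x y hx hy => simp only [map_add, hx, hy]
    | tmul x y =>
      simp only [Algebra.TensorProduct.map_tmul, Algebra.TensorProduct.comm_tmul,
        AlgHom.id_apply, leftCoaction_apply, LinearMap.rTensor_tmul]
      generalize comul (R := F) x = v
      induction v with
      | zero => simp
      | add x y hx hy =>
        simp only [map_add, TensorProduct.add_tmul, TensorProduct.tmul_add, hx, hy]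
      | tmul x y => simp [L]
  have h₂ (w : A ⊗[F] A) : Algebra.TensorProduct.leftComm F B B A
      (Algebra.TensorProduct.map (AlgHom.id F B) (rightCoaction' φ)
        (Algebra.TensorProduct.map (φ : A →ₐ[F] B) (AlgHom.id F A) w)) =
      L (LinearMap.lTensor A comul w) := by
    induction w with
    | zero => simp only [map_zero]
    | add x y hx hy => simp only [map_add, hx, hy]
    | tmul x y =>
      simp only [Algebra.TensorProduct.map_tmul, AlgHom.id_apply,
        rightCoaction'_apply, LinearMap.lTensor_tmul]
      generalize comul (R := F) y = v
      induction v with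
      | zero => simp
      | add x y hx hy =>
        simp only [map_add, TensorProduct.tmul_add, hx, hy]
      | tmul x y => simp [L]
  ext a
  exact (h₁ _).trans ((congrArg L (coassoc_apply a)).trans (h₂ _).symm)

lemma leftCoaction_counit :
    (Algebra.TensorProduct.lift ((Algebra.ofId F A).comp (Bialgebra.counitAlgHom F B))
      (AlgHom.id F A) fun _ _ => Commute.all _ _).comp (leftCoaction φ) = AlgHom.id F A := by
  ext a
  have h (w : A ⊗[F] A) : Algebra.TensorProduct.lift
      ((Algebra.ofId F A).comp (Bialgebra.counitAlgHom F B)) (AlgHom.id F A)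
      (fun _ _ => Commute.all _ _)
      (Algebra.TensorProduct.map (φ : A →ₐ[F] B) (AlgHom.id F A) w) =
      TensorProduct.lid F A (LinearMap.rTensor A counit w) := by
    induction w with
    | zero => simp only [map_zero]
    | add x y hx hy => simp only [map_add, hx, hy]
    | tmul x y => simp [Algebra.ofId_apply, Algebra.smul_def]
  refine (h (comul (R := F) a)).trans ?_
  rw [rTensor_counit_comul]
  simp

lemma rightCoaction'_counit :
    (Algebra.TensorProduct.lift ((Algebra.ofId F A).comp (Bialgebra.counitAlgHom F B))
      (AlgHom.id F A) fun _ _ => Commute.all _ _).comp (rightCoaction' φ) = AlgHom.id F A := by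
  ext a
  have h (w : A ⊗[F] A) : Algebra.TensorProduct.lift
      ((Algebra.ofId F A).comp (Bialgebra.counitAlgHom F B)) (AlgHom.id F A)
      (fun _ _ => Commute.all _ _)
      (Algebra.TensorProduct.comm F A B
        (Algebra.TensorProduct.map (AlgHom.id F A) (φ : A →ₐ[F] B) w)) =
      TensorProduct.rid F A (LinearMap.lTensor A counit w) := by
    induction w with
    | zero => simp only [map_zero]
    | add x y hx hy => simp only [map_add, hx, hy]
    | tmul x y => simp [Algebra.ofId_apply, Algebra.smul_def]
  refine (h (comul (R := F) a)).trans ?_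
  rw [lTensor_counit_comul]
  simp

end Coactions

/-! ### Characters of the torus, Galois descent and anisotropy -/

section Characters

variable {F K B X : Type*} [Field F] [Field K] [Algebra F K] [CommRing B] [HopfAlgebra F B]
  [CommGroup X]

variable (F K B X) in
/-- A basis of `K[T]` consisting of a group `X` of characters of `T` over `K`. -/
structure CharacterBasis where
  /-- The function on `T` given by a character. -/
  char : X →* K ⊗[F] B
  /-- The characters as a basis. -/
  basis : Module.Basis X K (K ⊗[F] B)
  basis_apply : ∀ x, basis x = char x
  comul_char : ∀ x, bc K (Bialgebra.comulAlgHom F B) (char x) = inl B (char x) * inr B (char x)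
  counit_char : ∀ x, bc K (Bialgebra.counitAlgHom F B) (char x) = 1

lemma bc_comul_of_isGroupLikeElem {u : K ⊗[F] B} (hu : IsGroupLikeElem K u) :
    bc K (Bialgebra.comulAlgHom F B) u = inl B u * inr B u := by
  let θ : (K ⊗[F] B) ⊗[K] (K ⊗[F] B) →ₐ[K] K ⊗[F] (B ⊗[F] B) :=
    Algebra.TensorProduct.lift (inl B) (inr B) fun _ _ => Commute.all _ _
  have h (z : K ⊗[F] B) :
      θ (Coalgebra.comul (R := K) z) = bc K (Bialgebra.comulAlgHom F B) z := by
    induction z with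
    | zero => simp only [map_zero]
    | add x y hx hy => simp only [map_add, hx, hy]
    | tmul k a =>
      rw [TensorProduct.comul_tmul, bc_tmul, Bialgebra.comulAlgHom_apply]
      generalize Coalgebra.comul (R := F) a = w
      induction w with
      | zero => simp only [map_zero, TensorProduct.tmul_zero]
      | add x y hx hy => simp only [map_add, TensorProduct.tmul_add, hx, hy]
      | tmul x y => simp [θ]
  rw [← h, hu.comul_eq_tmul_self]
  simp [θ]

lemma bc_counit_of_isGroupLikeElem {u : K ⊗[F] B} (hu : IsGroupLikeElem K u) :
    bc K (Bialgebra.counitAlgHom F B) u = 1 := by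
  have h (z : K ⊗[F] B) :
      Coalgebra.counit (R := K) z ⊗ₜ[F] (1 : F) = bc K (Bialgebra.counitAlgHom F B) z := by
    induction z with
    | zero => simp
    | add x y hx hy => simp only [map_add, TensorProduct.add_tmul, hx, hy]
    | tmul k a => simp [TensorProduct.smul_tmul]
  rw [← h, hu.counit_eq_one]
  rfl

lemma IsTorus.exists_characterBasis (hT : IsTorus F K B) :
    ∃ n : ℕ, Nonempty (CharacterBasis F K B (Multiplicative (Fin n → ℤ))) := by
  obtain ⟨n, ⟨e⟩⟩ := hT
  have he (x : Multiplicative (Fin n → ℤ)) :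
      IsGroupLikeElem K (e.symm (AddMonoidAlgebra.of K (Fin n → ℤ) x)) :=
    (isGroupLikeElem_map_equiv e.symm).2 (AddMonoidAlgebra.isGroupLikeElem_single_one x.toAdd)
  refine ⟨n, ⟨{
    char := (MonoidHomClass.toMonoidHom e.symm).comp (AddMonoidAlgebra.of K (Fin n → ℤ))
    basis := ((AddMonoidAlgebra.basis (Fin n → ℤ) K).map
      (e.symm : AddMonoidAlgebra K (Fin n → ℤ) ≃ₐ[K] K ⊗[F] B).toLinearEquiv).reindex
        Multiplicative.ofAdd
    basis_apply := fun x => ?_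
    comul_char := fun x => bc_comul_of_isGroupLikeElem (he x)
    counit_char := fun x => bc_counit_of_isGroupLikeElem (he x) }⟩⟩
  simp

namespace CharacterBasis

variable (c : CharacterBasis F K B X)

lemma char_ne_zero (x : X) : c.char x ≠ 0 := by
  rw [← c.basis_apply]
  exact c.basis.ne_zero x

/-- A `K`-point of a torus with prescribed values of the characters. -/
lemma exists_point (ψ : X →* Kˣ) : ∃ t : B →ₐ[F] K, ∀ x, ev t (c.char x) = ψ x := by
  let L : K ⊗[F] B →ₗ[K] K := c.basis.constr K fun x => (ψ x : K)
  have hL (x : X) : L (c.char x) = ψ x := by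
    rw [← c.basis_apply]
    exact c.basis.constr_basis K _ x
  -- The characters form a basis closed under multiplication, so multiplicativity of `L` need only
  -- be checked on them.
  have hmul : (LinearMap.mul K (K ⊗[F] B)).compr₂ L = (LinearMap.mul K K).compl₁₂ L L := by
    refine c.basis.ext fun x => c.basis.ext fun y => ?_
    simp only [LinearMap.compr₂_apply, LinearMap.compl₁₂_apply, LinearMap.mul_apply',
      c.basis_apply, hL]
    rw [← map_mul, hL, map_mul, Units.val_mul]
  let Φ : K ⊗[F] B →ₐ[K] K := AlgHom.ofLinearMap L
    (by simpa using hL 1) (fun u v => LinearMap.congr_fun₂ hmul u v)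
  refine ⟨(Φ.restrictScalars F).comp includeRight, fun x => ?_⟩
  have hΦ (z : K ⊗[F] B) : ev ((Φ.restrictScalars F).comp includeRight) z = Φ z := by
    induction z with
    | zero => simp only [map_zero]
    | add x y hx hy => simp only [map_add, hx, hy]
    | tmul k a =>
      rw [ev_tmul, ← smul_eq_mul, AlgHom.comp_apply, AlgHom.restrictScalars_apply, ← map_smul]
      simp [TensorProduct.smul_tmul']
  exact (hΦ _).trans (hL x)

/-- Every group-like function is a character. -/
lemma exists_eq_char {u : K ⊗[F] B} (hu : u ≠ 0)
    (h : bc K (Bialgebra.comulAlgHom F B) u = inl B u * inr B u) : ∃ x, u = c.char x := by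
  have hsum : u = ∑ x ∈ (c.basis.repr u).support, c.basis.repr u x • c.char x := by
    conv_lhs => rw [← c.basis.linearCombination_repr u]
    simp [Finsupp.linearCombination_apply, Finsupp.sum, c.basis_apply]
  obtain ⟨x, hx⟩ : (c.basis.repr u).support.Nonempty := by
    simpa [Finsupp.support_nonempty_iff] using hu
  refine ⟨x, ?_⟩
  -- Expanding `u` in characters turns the group-like equation into two expansions along the first
  -- factor. The coefficient of an `x` in the support is a nonzero scalar times `c.char x` in one
  -- and the same scalar times `u` in the other.
  have key : ∑ x ∈ (c.basis.repr u).support,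
      inl B (c.basis x) * inr B (c.basis.repr u x • c.char x) =
      ∑ x ∈ (c.basis.repr u).support, inl B (c.basis x) * inr B (c.basis.repr u x • u) := by
    have h₁ : bc K (Bialgebra.comulAlgHom F B) u = ∑ x ∈ (c.basis.repr u).support,
        inl B (c.basis x) * inr B (c.basis.repr u x • c.char x) := by
      conv_lhs => rw [hsum]
      rw [map_sum]
      refine Finset.sum_congr rfl fun x _ => ?_
      rw [map_smul, map_smul, mul_smul_comm, c.comul_char, c.basis_apply]
    have h₂ : inl B u * inr B u = ∑ x ∈ (c.basis.repr u).support,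
        inl B (c.basis x) * inr B (c.basis.repr u x • u) := by
      conv_lhs => enter [1]; rw [hsum]
      rw [map_sum, Finset.sum_mul]
      refine Finset.sum_congr rfl fun x _ => ?_
      rw [map_smul, map_smul, mul_smul_comm, smul_mul_assoc, c.basis_apply]
    rw [← h₁, ← h₂, h]
  have := eq_of_sum_eq_sum c.basis key hx
  exact (smul_right_injective _ (Finsupp.mem_support_iff.mp hx) this).symm

/-- The comultiplication is defined over `F`, so conjugation preserves group-like functions, and
these are all characters. -/
lemma exists_gal_char (σ : K ≃ₐ[F] K) (x : X) : ∃ y, gal σ B (c.char x) = c.char y := by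
  refine c.exists_eq_char (fun h => c.char_ne_zero x ?_) ?_
  · rw [← gal_one (c.char x), ← inv_mul_cancel σ, ← gal_gal, h, map_zero]
  · rw [← gal_bc, c.comul_char, map_mul, gal_bc, gal_bc]

end CharacterBasis

/-- Galois descent for elements. -/
lemma exists_eq_one_tmul [IsGalois F K] {M : Type*} [CommRing M] [Algebra F M] {u : K ⊗[F] M}
    (hu : ∀ σ : K ≃ₐ[F] K, gal σ M u = u) : ∃ m : M, u = 1 ⊗ₜ m := by
  classical
  let b := Module.Free.chooseBasis F M
  let E := TensorProduct.equivFinsuppOfBasisRight (M := K) b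
  have hE (σ : K ≃ₐ[F] K) (z : K ⊗[F] M) (i) : E (gal σ M z) i = σ (E z i) := by
    induction z with
    | zero => simp
    | add x y hx hy => simp [hx, hy]
    | tmul k m => simp [E]
  -- In a basis of `M` over `F` the Galois group acts coordinatewise, so the coordinates of an
  -- invariant element lie in `F`.
  have hfix (i) : E u i ∈ Set.range (algebraMap F K) :=
    (InfiniteGalois.mem_range_algebraMap_iff_fixed _).2 fun σ => by rw [← hE, hu]
  choose r hr using hfix
  refine ⟨∑ i ∈ (E u).support, r i • b i, ?_⟩
  conv_lhs => rw [← E.symm_apply_apply u]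
  simp only [E, TensorProduct.equivFinsuppOfBasisRight_symm_apply, Finsupp.sum,
    TensorProduct.tmul_sum]
  refine Finset.sum_congr rfl fun i _ => ?_
  rw [← TensorProduct.smul_tmul, Algebra.smul_def, mul_one, hr]

/-- The powers of a group-like element define a Hopf algebra map from `F[T;T⁻¹]` sending the
variable to it; anisotropy makes this map trivial. -/
lemma IsAnisotropic.eq_one_of_isGroupLikeElem (hTa : IsAnisotropic F B) {b : B}
    (hb : IsGroupLikeElem F b) : b = 1 := by
  let β : GroupLike F B := ⟨b, hb⟩
  let ψ : F[T;T⁻¹] →ₐ[F] B := AddMonoidAlgebra.lift F B ℤ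
    ((GroupLike.valMonoidHom F B).comp (zpowersHom _ β))
  have hψ (m : ℤ) : ψ (LaurentPolynomial.T m) = (β ^ m).val := by
    exact (AddMonoidAlgebra.lift_single _ _ _).trans (by simp)
  let χ : F[T;T⁻¹] →ₐc[F] B := BialgHom.ofAlgHom ψ
    (by ext m; simp [hψ])
    (by ext m; simp [hψ])
  have h := DFunLike.congr_fun (hTa χ) (LaurentPolynomial.T 1)
  have h₁ : χ (LaurentPolynomial.T 1) = b := by
    simp [χ, hψ, β]
  rw [← h₁, h]
  simp

/-- A character of an anisotropic torus fixed by the Galois group is trivial. -/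
lemma CharacterBasis.char_eq_one [IsGalois F K] (c : CharacterBasis F K B X)
    (hTa : IsAnisotropic F B) {x : X} (hx : ∀ σ : K ≃ₐ[F] K, gal σ B (c.char x) = c.char x) :
    c.char x = 1 := by
  obtain ⟨b, hb⟩ := exists_eq_one_tmul hx
  have h₁ := c.comul_char x
  have h₂ := c.counit_char x
  rw [hb] at h₁ h₂ ⊢
  rw [hTa.eq_one_of_isGroupLikeElem (b := b) ⟨?_, ?_⟩]
  · rfl
  · exact Algebra.TensorProduct.includeRight_injective (A := K) (algebraMap F K).injective
      (by simpa [Algebra.TensorProduct.one_def] using h₂)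
  · exact Algebra.TensorProduct.includeRight_injective (A := K) (algebraMap F K).injective
      (by simpa using h₁)

/-- The conjugates of a scalar are among the roots of its minimal polynomial, and an element of the
tensor product involves finitely many scalars. -/
lemma finite_range_gal [Algebra.IsAlgebraic F K] {M : Type*} [CommRing M] [Algebra F M]
    (u : K ⊗[F] M) : (Set.range fun σ : K ≃ₐ[F] K => gal σ M u).Finite := by
  induction u with
  | zero => simp
  | add x y hx hy =>
    refine (hx.image2 (· + ·) hy).subset ?_
    rintro _ ⟨σ, rfl⟩
    exact ⟨_, ⟨σ, rfl⟩, _, ⟨σ, rfl⟩, by simp⟩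
  | tmul k m =>
    refine ((((minpoly F k).rootSet_finite K)).image fun l => l ⊗ₜ[F] m).subset ?_
    rintro _ ⟨σ, rfl⟩
    refine ⟨σ k, ?_, rfl⟩
    rw [Polynomial.mem_rootSet]
    refine ⟨minpoly.ne_zero (Algebra.IsIntegral.isIntegral k), ?_⟩
    exact (Polynomial.aeval_algHom_apply σ k _).trans (by simp)

/-- A monoid of pairs of characters of an anisotropic torus that is stable under the Galois group
is stable under inverses. -/
lemma CharacterBasis.inv_mem [IsGalois F K] (c : CharacterBasis F K B X)
    (hTa : IsAnisotropic F B) (S : Submonoid ((K ⊗[F] B) × (K ⊗[F] B)))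
    (hS : ∀ (σ : K ≃ₐ[F] K), ∀ p ∈ S, (gal σ B p.1, gal σ B p.2) ∈ S) {x y : X}
    (hxy : (c.char x, c.char y) ∈ S) : (c.char x⁻¹, c.char y⁻¹) ∈ S := by
  classical
  let G (σ : K ≃ₐ[F] K) : (K ⊗[F] B) × (K ⊗[F] B) →* (K ⊗[F] B) × (K ⊗[F] B) :=
    MonoidHom.prodMap (gal σ B : K ⊗[F] B →* K ⊗[F] B) (gal σ B : K ⊗[F] B →* K ⊗[F] B)
  have hG (σ τ p) : G σ (G τ p) = G (σ * τ) p := Prod.ext (gal_gal σ τ _) (gal_gal σ τ _)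
  have hG1 (p) : G 1 p = p := Prod.ext (gal_one _) (gal_one _)
  set p : (K ⊗[F] B) × (K ⊗[F] B) := (c.char x, c.char y) with hp
  have hfin : (Set.range fun σ => G σ p).Finite := by
    refine ((finite_range_gal (c.char x)).prod (finite_range_gal (c.char y))).subset ?_
    rintro _ ⟨σ, rfl⟩
    exact ⟨⟨σ, rfl⟩, ⟨σ, rfl⟩⟩
  -- The Galois orbit of `p`, without repetition. Each `G σ` permutes it, so its product is
  -- Galois-invariant.
  let O := hfin.toFinset
  have hO {q} : q ∈ O ↔ ∃ σ, G σ p = q := by simp [O]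
  have himage (σ) : O.image (G σ) = O := by
    ext q
    simp only [Finset.mem_image, hO]
    constructor
    · rintro ⟨_, ⟨τ, rfl⟩, rfl⟩
      exact ⟨σ * τ, (hG _ _ _).symm⟩
    · rintro ⟨τ, rfl⟩
      exact ⟨_, ⟨σ⁻¹ * τ, rfl⟩, by rw [hG, mul_inv_cancel_left]⟩
  have hinj (σ) : Function.Injective (G σ) := fun q r h => by
    have := congrArg (G σ⁻¹) h
    rwa [hG, hG, inv_mul_cancel, hG1, hG1] at this
  have hfix (σ) : G σ (∏ q ∈ O, q) = ∏ q ∈ O, q := by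
    rw [map_prod]
    conv_rhs => rw [← himage σ]
    rw [Finset.prod_image fun _ _ _ _ h => hinj σ h]
  have hchar : ∏ q ∈ O, q ∈ (MonoidHom.mrange c.char).prod (MonoidHom.mrange c.char) := by
    refine Submonoid.prod_mem _ fun q hq => ?_
    obtain ⟨σ, rfl⟩ := hO.1 hq
    obtain ⟨a, ha⟩ := c.exists_gal_char σ x
    obtain ⟨b, hb⟩ := c.exists_gal_char σ y
    exact ⟨⟨a, ha.symm⟩, ⟨b, hb.symm⟩⟩
  have hone : ∏ q ∈ O, q = 1 := by
    obtain ⟨⟨a, ha⟩, ⟨b, hb⟩⟩ := hchar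
    refine Prod.ext ?_ ?_
    · rw [← ha]
      refine c.char_eq_one hTa fun σ => ?_
      rw [ha]
      exact congrArg Prod.fst (hfix σ)
    · rw [← hb]
      refine c.char_eq_one hTa fun σ => ?_
      rw [hb]
      exact congrArg Prod.snd (hfix σ)
  have hpO : p ∈ O := hO.2 ⟨1, hG1 p⟩
  rw [← Finset.mul_prod_erase O (fun q => q) hpO] at hone
  -- The product of the remaining conjugates lies in `S` and is an inverse of `p`.
  have hQ : ∏ q ∈ O.erase p, q ∈ S := by
    refine Submonoid.prod_mem _ fun q hq => ?_
    obtain ⟨σ, rfl⟩ := hO.1 (Finset.mem_of_mem_erase hq)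
    exact hS σ p hxy
  have hinv : (c.char x⁻¹, c.char y⁻¹) * p = 1 := by
    simp [hp, ← map_mul]
  rwa [← left_inv_eq_right_inv hinv hone] at hQ

end Characters

/-- Characters of a subgroup with values in an algebraically closed field extend. -/
lemma exists_monoidHom_extension {K Y : Type*} [Field K] [IsAlgClosed K] [CommGroup Y]
    (H : Subgroup Y) (γ : H →* Kˣ) : ∃ Γ : Y →* Kˣ, ∀ q : H, Γ q = γ q := by
  -- Roots exist in `K`, so `Kˣ` is divisible and therefore an injective abelian group.
  let _ : DivisibleBy (Additive Kˣ) ℕ := divisibleByOfSMulRightSurj _ _ fun {n} hn a => by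
    obtain ⟨z, hz⟩ := IsAlgClosed.exists_pow_nat_eq (a.toMul : K) (Nat.pos_of_ne_zero hn)
    have hz0 : z ≠ 0 := by
      rintro rfl
      rw [zero_pow hn] at hz
      exact a.toMul.ne_zero hz.symm
    exact ⟨Additive.ofMul (Units.mk0 z hz0), Units.ext hz⟩
  let _ : DivisibleBy (Additive Kˣ) ℤ := AddGroup.divisibleByIntOfDivisibleByNat _
  obtain ⟨Γ, hΓ⟩ := (Module.Baer.of_divisible (Additive Kˣ)).extension_property_addMonoidHom
    (MonoidHom.toAdditive H.subtype) (fun a b h => H.subtype_injective h) (MonoidHom.toAdditive γ)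
  exact ⟨MonoidHom.toAdditive.symm Γ, fun q => DFunLike.congr_fun hΓ (Additive.ofMul q)⟩

/-! ### Weights at a point, and equations of its double orbit -/

section Biweight

variable {F K A B X : Type*} [Field F] [Field K] [Algebra F K] [CommRing A] [HopfAlgebra F A]
  [CommRing B] [HopfAlgebra F B] [CommGroup X] (φ : A →ₐc[F] B)

/-- The function `f` is a common weight vector for left and right translations by `T`. -/
def IsBiweight (p : (K ⊗[F] B) × (K ⊗[F] B)) (f : K ⊗[F] A) : Prop :=
  IsWeight (leftCoaction φ) p.1 f ∧ IsWeight (rightCoaction' φ) p.2 f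

variable {φ} in
lemma IsBiweight.mul {p q : (K ⊗[F] B) × (K ⊗[F] B)} {f g : K ⊗[F] A} (hf : IsBiweight φ p f)
    (hg : IsBiweight φ q g) : IsBiweight φ (p * q) (f * g) :=
  ⟨hf.1.mul hg.1, hf.2.mul hg.2⟩

lemma IsBiweight.one : IsBiweight φ (1 : (K ⊗[F] B) × (K ⊗[F] B)) 1 := ⟨.one, .one⟩

/-- The weights of the functions that do not vanish at the point `g`. -/
def weights (g : A →ₐ[F] K) : Submonoid ((K ⊗[F] B) × (K ⊗[F] B)) where
  carrier := {p | ∃ f, IsBiweight φ p f ∧ ev g f ≠ 0}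
  one_mem' := ⟨1, .one φ, by simp⟩
  mul_mem' := by
    rintro p q ⟨f, hf, hf0⟩ ⟨f', hf', hf'0⟩
    exact ⟨f * f', hf.mul hf', by simp [hf0, hf'0]⟩

lemma gal_mem_weights (g : A →ₐ[F] F) (σ : K ≃ₐ[F] K) (p : (K ⊗[F] B) × (K ⊗[F] B))
    (hp : p ∈ weights φ ((Algebra.ofId F K).comp g)) :
    (gal σ B p.1, gal σ B p.2) ∈ weights φ ((Algebra.ofId F K).comp g) := by
  obtain ⟨f, hf, hf0⟩ := hp
  exact ⟨gal σ A f, ⟨hf.1.gal σ, hf.2.gal σ⟩, by simpa [ev_gal] using hf0⟩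

lemma ofConv_subgroupPoint_mul (t : Points F B K) (h : Points F A K) :
    (subgroupPoint φ t * h).ofConv =
      (Algebra.TensorProduct.lift t.ofConv h.ofConv fun _ _ => Commute.all _ _).comp
        (leftCoaction φ) := by
  ext a
  refine (AlgHom.convMul_apply _ _ a).trans ?_
  rw [AlgHom.comp_apply, leftCoaction_apply]
  generalize Coalgebra.comul (R := F) a = w
  induction w with
  | zero => simp only [map_zero]
  | add x y hx hy => simp only [map_add, hx, hy]
  | tmul x y => simp [subgroupPoint]

lemma ofConv_mul_subgroupPoint (t : Points F B K) (h : Points F A K) :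
    (h * subgroupPoint φ t).ofConv =
      (Algebra.TensorProduct.lift t.ofConv h.ofConv fun _ _ => Commute.all _ _).comp
        (rightCoaction' φ) := by
  ext a
  refine (AlgHom.convMul_apply _ _ a).trans ?_
  rw [AlgHom.comp_apply, rightCoaction'_apply]
  generalize Coalgebra.comul (R := F) a = w
  induction w with
  | zero => simp only [map_zero]
  | add x y hx hy => simp only [map_add, hx, hy]
  | tmul x y => simp [subgroupPoint, mul_comm]

variable {φ} in
lemma IsBiweight.evalAt_translate {p : (K ⊗[F] B) × (K ⊗[F] B)} {f : K ⊗[F] A}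
    (hf : IsBiweight φ p f) (g : Points F A K) (tL tR : Points F B K) :
    evalAt (subgroupPoint φ tL * g * subgroupPoint φ tR) f =
      ev tR.ofConv p.2 * (ev tL.ofConv p.1 * evalAt g f) := by
  change ev (subgroupPoint φ tL * g * subgroupPoint φ tR).ofConv f = _
  rw [ofConv_mul_subgroupPoint, hf.2.ev_lift, ofConv_subgroupPoint_mul, hf.1.ev_lift]
  rfl

/-- A point at which every weight vector vanishing at `g` vanishes lies in the double orbit of `g`,
if the weights at `g` form a group. -/
lemma mem_doubleOrbit [IsAlgClosed K] (c : CharacterBasis F K B X) (g h : Points F A K)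
    (hinv : ∀ x y, (c.char x, c.char y) ∈ weights φ g.ofConv →
      (c.char x⁻¹, c.char y⁻¹) ∈ weights φ g.ofConv)
    (hgh : ∀ x y f, IsBiweight φ (c.char x, c.char y) f → evalAt g f = 0 → evalAt h f = 0) :
    h ∈ doubleOrbit φ g := by
  -- The weights at `g`, transported to the character group; `hinv` makes them a group.
  let H : Subgroup (X × X) :=
    { (weights φ g.ofConv).comap (c.char.prodMap c.char) with
      inv_mem' := fun {q} hq => hinv q.1 q.2 hq }
  have hex (q : H) : ∃ f, IsBiweight φ (c.char q.1.1, c.char q.1.2) f ∧ evalAt g f = 1 := by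
    obtain ⟨f, hf, hf0⟩ := q.2
    refine ⟨(evalAt g f)⁻¹ • f, ⟨hf.1.smul _, hf.2.smul _⟩, ?_⟩
    rw [map_smul, smul_eq_mul]
    exact inv_mul_cancel₀ hf0
  choose f hf hf1 using hex
  -- The function `f' - f'(g) • f q` is a weight vector vanishing at `g`, so it also vanishes at
  -- `h`.
  have key (q : H) (f' : K ⊗[F] A) (hf' : IsBiweight φ (c.char q.1.1, c.char q.1.2) f') :
      evalAt h f' = evalAt g f' * evalAt h (f q) := by
    have := hgh q.1.1 q.1.2 (f' - evalAt g f' • f q)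
      ⟨hf'.1.sub ((hf q).1.smul _), hf'.2.sub ((hf q).2.smul _)⟩ (by simp [hf1])
    rwa [map_sub, map_smul, smul_eq_mul, sub_eq_zero] at this
  let γ : H →* K :=
    { toFun := fun q => evalAt h (f q)
      map_one' := by simpa using (key 1 1 (by simpa [Prod.mk_one_one] using IsBiweight.one φ)).symm
      map_mul' := fun q r => by
        have := key (q * r) (f q * f r) (by simpa using (hf q).mul (hf r))
        simpa [hf1] using this.symm }
  -- The values of `γ` are units because its source is a group.
  obtain ⟨Γ, hΓ⟩ := exists_monoidHom_extension H γ.toHomUnits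
  obtain ⟨tL, htL⟩ := c.exists_point (Γ.comp (MonoidHom.inl X X))
  obtain ⟨tR, htR⟩ := c.exists_point (Γ.comp (MonoidHom.inr X X))
  refine ⟨WithConv.toConv tL, WithConv.toConv tR, ?_⟩
  set h' := subgroupPoint φ (WithConv.toConv tL) * g * subgroupPoint φ (WithConv.toConv tR)
  let S : AddSubmonoid (K ⊗[F] A) :=
    { carrier := {z | evalAt h z = evalAt h' z}
      zero_mem' := by simp
      add_mem' := fun {a b} ha hb => by
        simp only [Set.mem_ofPred_eq] at ha hb ⊢
        rw [map_add, map_add, ha, hb] }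
  have hS (z : K ⊗[F] A) : z ∈ S := by
    have hcomul (x : X) : bc K (Bialgebra.comulAlgHom F B) (c.basis x) =
        inl B (c.basis x) * inr B (c.basis x) := by
      rw [c.basis_apply, c.comul_char]
    refine mem_of_isWeight_mem c.basis (ε := Bialgebra.counitAlgHom F B) hcomul ?_ ?_
      (leftCoaction_coassoc φ) (rightCoaction'_coassoc φ) (leftCoaction_rightCoaction'_comm φ)
      (leftCoaction_counit φ) (rightCoaction'_counit φ) S ?_ z
    -- Characters remain group-like for the flipped comultiplication because `K ⊗ (B ⊗ B)` is
    -- commutative.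
    · intro x
      rw [bc_comp, hcomul, map_mul, mul_comm]
      congr 1
      · exact bc_bc_of_comp_eq (by ext; simp) _
      · exact bc_bc_of_comp_eq (by ext; simp) _
    · intro x
      rw [c.basis_apply, c.counit_char]
    · intro x y z hx hy
      rw [c.basis_apply] at hx hy
      have hz : IsBiweight φ (c.char x, c.char y) z := ⟨hx, hy⟩
      change evalAt h z = evalAt h' z
      rw [hz.evalAt_translate]
      by_cases h0 : evalAt g z = 0
      · rw [h0, hgh x y z hz h0, mul_zero, mul_zero]
      · let q : H := ⟨(x, y), z, hz, h0⟩
        have hq : (Γ (x, y) : K) = evalAt h (f q) := congrArg Units.val (hΓ q)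
        have hxy : (x, y) = (x, 1) * (1, y) := by simp
        rw [key q z hz, ← hq, hxy, map_mul]
        simp only [htL, htR, MonoidHom.comp_apply, MonoidHom.inl_apply, MonoidHom.inr_apply,
          Units.val_mul]
        ring
  apply WithConv.ofConv_injective
  ext a
  have ha : evalAt h (1 ⊗ₜ a) = evalAt h' (1 ⊗ₜ a) := hS (1 ⊗ₜ a)
  simpa [evalAt] using ha

/-- Points with the same image in the double quotient agree on invariant functions over `K`. -/
lemma ev_eq_of_eqOn_invariants {g g' : A →ₐ[F] K} (h : ∀ a ∈ invariants φ, g a = g' a)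
    {f : K ⊗[F] A} (hf : IsBiweight φ 1 f) : ev g f = ev g' f := by
  classical
  -- The coactions are defined over `F`, so the coordinates of `f` along a basis of `K` over `F` are
  -- themselves invariant functions in `A`.
  let b := Module.Free.chooseBasis F K
  have hE {M : Type _} [CommRing M] [Algebra F M] (θ : A →ₐ[F] M) (z : K ⊗[F] A) (i) :
      TensorProduct.equivFinsuppOfBasisLeft b (bc K θ z) i =
        θ (TensorProduct.equivFinsuppOfBasisLeft b z i) := by
    induction z with
    | zero => simp
    | add x y hx hy => simp [hx, hy]
    | tmul k m => simp
  set e := TensorProduct.equivFinsuppOfBasisLeft (N := A) b f with he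
  have hinv (i) : e i ∈ invariants φ := by
    have h₁ : bc K (leftCoaction φ) f = bc K includeRight f := by simpa [IsWeight] using hf.1
    have h₂ : bc K (rightCoaction' φ) f = bc K includeRight f := by simpa [IsWeight] using hf.2
    refine ⟨?_, ?_⟩
    · change leftCoaction φ (e i) = includeRight (e i)
      rw [he, ← hE, h₁, hE]
    · change rightCoaction φ (e i) = includeLeft (e i)
      apply (Algebra.TensorProduct.comm F A B).injective
      change rightCoaction' φ (e i) = _
      rw [he, ← hE, h₂, hE]
      simp
  rw [← (TensorProduct.equivFinsuppOfBasisLeft b).symm_apply_apply f,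
    TensorProduct.equivFinsuppOfBasisLeft_symm_apply, Finsupp.sum, map_sum, map_sum]
  exact Finset.sum_congr rfl fun i _ => by rw [ev_tmul, ev_tmul, h _ (hinv i)]

end Biweight

end

end DoubleTorusQuotient

/-! ### The main theorem -/

open DoubleTorusQuotient in
theorem mainTheorem5
    {F : Type*} [Field F] [CharZero F]
    (K : Type*) [Field K] [Algebra F K] [IsAlgClosure F K]
    {A : Type*} [CommRing A] [HopfAlgebra F A] [Algebra.FiniteType F A]
    {B : Type*} [CommRing B] [HopfAlgebra F B]
    (φ : A →ₐc[F] B) (hφ : Function.Surjective φ)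
    (hT : IsTorus F K B) (hTa : IsAnisotropic F B) :
    (∀ g : Points F A F, IsZariskiClosed (doubleOrbit φ (extendPoint K g))) ∧
    (∀ g : Points F A F, quotientMap φ g = quotientMap φ 1 →
      ∃ t : Points F B F, subgroupPoint φ t = g) := by
  have : IsAlgClosed K := IsAlgClosure.isAlgClosed F
  have : Algebra.IsAlgebraic F K := IsAlgClosure.isAlgebraic
  have : Normal F K := IsAlgClosure.normal F K
  -- Separability comes from characteristic zero.
  have : IsGalois F K := {}
  obtain ⟨n, ⟨c⟩⟩ := hT.exists_characterBasis
  have hinv (g : Points F A F) (x y) :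
      (c.char x, c.char y) ∈ weights φ (extendPoint K g).ofConv →
        (c.char x⁻¹, c.char y⁻¹) ∈ weights φ (extendPoint K g).ofConv :=
    c.inv_mem hTa _ (gal_mem_weights φ g.ofConv)
  refine ⟨fun g => ⟨{f | (∃ x y, IsBiweight φ (c.char x, c.char y) f) ∧
    evalAt (extendPoint K g) f = 0}, ?_⟩, fun g hg => ?_⟩
  · ext h
    constructor
    · rintro ⟨tL, tR, rfl⟩ f ⟨⟨x, y, hf⟩, hf0⟩
      rw [hf.evalAt_translate, hf0, mul_zero, mul_zero]
    · exact fun hh => mem_doubleOrbit φ c _ h (hinv g) fun x y f hf hf0 => hh f ⟨⟨x, y, hf⟩, hf0⟩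
  · have heq (a : A) (ha : a ∈ invariants φ) :
        (extendPoint K g).ofConv a = (extendPoint K (1 : Points F A F)).ofConv a :=
      congrArg (algebraMap F K) (DFunLike.congr_fun hg ⟨a, ha⟩)
    have hmem : extendPoint K g ∈ doubleOrbit φ (extendPoint K (1 : Points F A F)) := by
      refine mem_doubleOrbit φ c _ _ (hinv 1) fun x y f hf hf0 => ?_
      by_contra hne
      -- `f'` has the inverse weight and is nonzero at `g`, so `f * f'` is invariant, nonzero at `g`
      -- and zero at the identity.
      obtain ⟨f', hf', hne'⟩ := hinv g x y ⟨f, hf, hne⟩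
      have hone : IsBiweight φ 1 (f * f') := by
        have := hf.mul hf'
        rwa [Prod.mk_mul_mk, ← map_mul, ← map_mul, mul_inv_cancel, mul_inv_cancel, map_one] at this
      have hev := ev_eq_of_eqOn_invariants φ heq hone
      rw [map_mul, map_mul] at hev
      exact mul_ne_zero hne hne' (hev.trans (mul_eq_zero_of_left hf0 _))
    obtain ⟨tL, tR, ht⟩ := hmem
    have hone : extendPoint K (1 : Points F A F) = 1 := by
      apply WithConv.ofConv_injective
      ext a
      simp [extendPoint, AlgHom.convOne_def, Algebra.ofId_apply]
    -- Over `K` the point `g` equals `tL * tR`, hence kills the ideal of `T`; since `F` embeds in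
    -- `K`, this already holds over `F`, and `g` factors through `A / ker φ ≃ B`.
    have hker (a : A) (ha : φ a = 0) : g.ofConv a = 0 := by
      have hmul : subgroupPoint φ tL * subgroupPoint φ tR = subgroupPoint φ (tL * tR) :=
        WithConv.ofConv_injective (AlgHom.convMul_comp_bialgHom_distrib tL tR φ).symm
      rw [hone, mul_one, hmul] at ht
      have h₁ : algebraMap F K (g.ofConv a) = (tL * tR).ofConv (φ a) :=
        DFunLike.congr_fun (congrArg WithConv.ofConv ht) a
      rw [ha, map_zero] at h₁
      exact (map_eq_zero _).1 h₁
    let e := Ideal.quotientKerAlgEquivOfSurjective (f := (φ : A →ₐ[F] B)) hφ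
    refine ⟨WithConv.toConv ((Ideal.Quotient.liftₐ (RingHom.ker (φ : A →ₐ[F] B)) g.ofConv
      fun a ha => hker a ha).comp (e.symm : B →ₐ[F] _)), ?_⟩
    apply WithConv.ofConv_injective
    ext a
    have he : e.symm (φ a) = Ideal.Quotient.mk _ a := e.symm_apply_eq.2 rfl
    exact congrArg (Ideal.Quotient.liftₐ (RingHom.ker (φ : A →ₐ[F] B)) g.ofConv
      fun a ha => hker a ha) he
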